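/- All algebras are finite-dimensional over an arbitrary field $F$. A (right) Leibniz algebra is a vector space $L$ over $F$ with a bilinear product satisfying $[x,[y,z]]=[[x,y],z]-[[x,z],y]$ for all $x,y,z\in L$. For subspaces $U,V$ let $[U,V]$ be the span of all $[u,v]$, $u\in U$, $v\in V$. A subalgebra $U$ is abelian if $[U,U]=0$, and nilpotent if some term of the series $U^1=U$, $U^{k+1}=[U^k,U]$ is zero. $L$ is an $A$-algebra if all its nilpotent subalgebras are abelian. Put $L^{(0)}=L$, $L^{(k+1)}=[L^{(k)},L^{(k)}]$; $L$ is solvable of derived length $m$ if $m$ is the least integer with $L^{(m)}=0$. $L$ is monolithic with monolith $W$ if $W$ is its unique minimal (nonzero, two-sided) ideal. For a subspace $U$, $Z_L(U)=\{x\in L : [x,u]=[u,x]=0 \text{ for all } u\in U\}$, and $Z(L)=Z_L(L)$. The nilradical $N$ is the largest nilpotent ideal of $L$. The Frattini ideal $\phi(L)$ is the largest ideal of $L$ contained in all maximal subalgebras of $L$, and $L$ is $\phi$-free if $\phi(L)=0$. **Theorem 5.1.** Let $L$ be a monolithic solvable Leibniz $A$-algebra of derived length $n+1$ (where $n\ge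 0$) with monolith $W$. Then (i) $W$ is abelian; (ii) if $n\ge 1$ (equivalently, $L$ is not one-dimensional), then $Z(L)=0$, and $[L,W]=W$ or $[W,L]=W$; (iii) the nilradical exists and $N=L^{(n)}$; (iv) $N=Z_L(W)$; and (v) $L$ is $\phi$-free if and only if $W=N$. -/

import Mathlib

/-- The underlying ring structure of a (right) Leibniz algebra: a biadditive bracket for which
every right multiplication `y ↦ ⁅y, x⁆` is a derivation. No skew-symmetry is required. -/
class LeibnizRing (L : Type*) extends AddCommGroup L, Bracket L L where
  add_bracket : ∀ x y z : L, ⁅x + y, z⁆ = ⁅x, z⁆ + ⁅y, z⁆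
  bracket_add : ∀ x y z : L, ⁅x, y + z⁆ = ⁅x, y⁆ + ⁅x, z⁆
  leibniz : ∀ x y z : L, ⁅x, ⁅y, z⁆⁆ = ⁅⁅x, y⁆, z⁆ - ⁅⁅x, z⁆, y⁆

/-- A (right) Leibniz algebra over a field: the bracket is moreover bilinear. -/
class LeibnizAlgebra (F : Type*) (L : Type*) [Field F] [LeibnizRing L] extends Module F L where
  smul_bracket : ∀ (c : F) (x y : L), ⁅c • x, y⁆ = c • ⁅x, y⁆
  bracket_smul : ∀ (c : F) (x y : L), ⁅x, c • y⁆ = c • ⁅x, y⁆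

namespace Leibniz

variable {F L : Type*} [Field F] [LeibnizRing L] [LeibnizAlgebra F L]

theorem zero_bracket (x : L) : ⁅(0 : L), x⁆ = 0 := by
  have h := LeibnizRing.add_bracket (0 : L) 0 x
  simpa using h

theorem bracket_zero (x : L) : ⁅x, (0 : L)⁆ = 0 := by
  have h := LeibnizRing.bracket_add x (0 : L) 0
  simpa using h

/-- A subspace that is a subalgebra. -/
def IsSubalgebra (U : Submodule F L) : Prop :=
  ∀ x ∈ U, ∀ y ∈ U, ⁅x, y⁆ ∈ U

/-- A subspace that is a (two-sided) ideal. -/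
def IsIdeal (I : Submodule F L) : Prop :=
  ∀ x ∈ I, ∀ y : L, ⁅x, y⁆ ∈ I ∧ ⁅y, x⁆ ∈ I

/-- `[U, V]`, the subspace spanned by all products `⁅u, v⁆` with `u ∈ U` and `v ∈ V`. -/
def product (U V : Submodule F L) : Submodule F L :=
  Submodule.span F {z | ∃ x ∈ U, ∃ y ∈ V, ⁅x, y⁆ = z}

/-- All products of elements of `U` vanish. -/
def IsAbelian (U : Submodule F L) : Prop :=
  ∀ x ∈ U, ∀ y ∈ U, ⁅x, y⁆ = 0

/-- The lower central series `U ⊇ [U, U] ⊇ [[U, U], U] ⊇ …`, indexed from `0`. -/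
def lowerCentralSeries (U : Submodule F L) : ℕ → Submodule F L
  | 0 => U
  | k + 1 => product (lowerCentralSeries U k) U

def IsNilpotent (U : Submodule F L) : Prop :=
  ∃ k, lowerCentralSeries U k = ⊥

variable (F L) in
/-- The derived series `L⁽⁰⁾ = L`, `L⁽ᵏ⁺¹⁾ = [L⁽ᵏ⁾, L⁽ᵏ⁾]`. -/
def derivedSeries : ℕ → Submodule F L
  | 0 => ⊤
  | k + 1 => product (derivedSeries k) (derivedSeries k)

variable (F L) in
/-- `L` is solvable of derived length `m`. -/
def IsSolvableOfDerivedLength (m : ℕ) : Prop :=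
  IsLeast {k | derivedSeries F L k = ⊥} m

variable (F L) in
/-- `L` is an `A`-algebra: all its nilpotent subalgebras are abelian. -/
def IsAAlgebra : Prop :=
  ∀ U : Submodule F L, IsSubalgebra U → IsNilpotent U → IsAbelian U

/-- A minimal (nonzero) ideal. -/
def IsMinimalIdeal (I : Submodule F L) : Prop :=
  Minimal (fun J : Submodule F L => IsIdeal J ∧ J ≠ ⊥) I

/-- `L` is monolithic with monolith `W`: `W` is the unique minimal ideal of `L`. -/
def IsMonolith (W : Submodule F L) : Prop :=
  IsMinimalIdeal W ∧ ∀ I : Submodule F L, IsMinimalIdeal I → I = W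

/-- The two-sided centraliser of `U` in `L`. -/
def centralizer (U : Submodule F L) : Submodule F L where
  carrier := {x | ∀ u ∈ U, ⁅x, u⁆ = 0 ∧ ⁅u, x⁆ = 0}
  zero_mem' := fun u _ => ⟨zero_bracket u, bracket_zero u⟩
  add_mem' := fun {a b} ha hb u hu => by
    rw [LeibnizRing.add_bracket, LeibnizRing.bracket_add, (ha u hu).1, (ha u hu).2,
      (hb u hu).1, (hb u hu).2]
    simp
  smul_mem' := fun c a ha u hu => by
    rw [LeibnizAlgebra.smul_bracket, LeibnizAlgebra.bracket_smul, (ha u hu).1, (ha u hu).2]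
    simp

variable (F L) in
/-- The (two-sided) centre of `L`. -/
def center : Submodule F L := centralizer ⊤

variable (F L) in
/-- The nilpotent ideals of `L`. -/
def nilpotentIdeals : Set (Submodule F L) :=
  {I | IsIdeal I ∧ IsNilpotent I}

variable (F L) in
/-- The nilradical of `L`, as the sum of all nilpotent ideals. -/
def nilradical : Submodule F L := sSup (nilpotentIdeals F L)

/-- A maximal (proper) subalgebra. -/
def IsMaximalSubalgebra (M : Submodule F L) : Prop :=
  Maximal (fun U : Submodule F L => IsSubalgebra U ∧ U ≠ ⊤) M

variable (F L) in
/-- The ideals of `L` contained in every maximal subalgebra. -/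
def frattiniIdeals : Set (Submodule F L) :=
  {I | IsIdeal I ∧ ∀ M : Submodule F L, IsMaximalSubalgebra M → I ≤ M}

variable (F L) in
/-- The Frattini ideal of `L`: the largest ideal contained in all maximal subalgebras. -/
def frattini : Submodule F L := sSup (frattiniIdeals F L)

theorem isIdeal_sSup {S : Set (Submodule F L)} (hS : ∀ I ∈ S, IsIdeal I) : IsIdeal (sSup S) := by
  intro x hx y
  rw [sSup_eq_iSup'] at hx
  refine Submodule.iSup_induction (fun i : S => (i : Submodule F L))
    (motive := fun x => ⁅x, y⁆ ∈ sSup S ∧ ⁅y, x⁆ ∈ sSup S) hx ?_ ?_ ?_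
  · intro i a ha
    have h := hS i.1 i.2 a ha y
    exact ⟨le_sSup i.2 h.1, le_sSup i.2 h.2⟩
  · rw [zero_bracket, bracket_zero]
    exact ⟨zero_mem _, zero_mem _⟩
  · intro a b ha hb
    rw [LeibnizRing.add_bracket, LeibnizRing.bracket_add]
    exact ⟨add_mem ha.1 hb.1, add_mem ha.2 hb.2⟩

variable (F L) in
theorem isGreatest_frattini : IsGreatest (frattiniIdeals F L) (frattini F L) :=
  ⟨⟨isIdeal_sSup fun _ hI => hI.1, fun M hM => sSup_le fun _ hI => hI.2 M hM⟩,
    fun _ hI => le_sSup hI⟩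

variable (F L) in
def IsPhiFree : Prop := frattini F L = ⊥

end Leibniz

/-! By finite dimension `W` lies in every nonzero ideal. The lever is
`IsAAlgebra.eq_zero_of_mem_product`: if `[V, V]` is abelian, its Fitting null part `C₀` under `V` is
zero, because modulo the one-part `C₁` right multiplications are nilpotent, and a nilpotent quotient
lifts to a nilpotent, hence abelian, subalgebra, forcing `[V, V] ≤ C₁`.

A nonabelian ideal contains an ideal `V` with `[V, V]` nonzero and abelian, so `W ≤ [V, V]`. Inside
`W` this is absurd; inside the centralizer of `W` it makes `V` annihilate `W`, against the lever. So
both are abelian. The lever also kills the centralizer of the penultimate derived term, hence the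
centre. A second Fitting argument, `IsAAlgebra.le_product_of_disjoint_centralizer`, pushes the
centralizer of `W` into the last derived term. Nilpotent ideals are abelian and, if nonzero, contain
`W`, so they centralize it. For φ-freeness, maximal subalgebras missing `W` are compared with
Fitting null-components. -/

open scoped IsMulCommutative in
/-- For pairwise commuting endomorphisms of a finite-dimensional space there is an idempotent
projecting onto the Fitting one-component along the Fitting null-component. -/
theorem Module.End.exists_fitting_idempotent {F M : Type*} [Field F] [AddCommGroup M] [Module F M]
    [FiniteDimensional F M] (S : Set (Module.End F M))
    (hS : ∀ s ∈ S, ∀ t ∈ S, s * t = t * s) :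
    ∃ e : Module.End F M, e * e = e ∧
      (∀ f : Module.End F M, (∀ s ∈ S, Commute s f) → Commute e f) ∧
      (∃ k, ∀ s ∈ S, s ^ k * (1 - e) = 0) ∧
      (∀ P : Submodule F M, (∀ s ∈ S, ∀ m, s m ∈ P) → ∀ m, e m ∈ P) ∧
      (∀ m, (∀ s ∈ S, s m = 0) → e m = 0) := by
  have := Algebra.isMulCommutative_adjoin F hS
  let R := Algebra.adjoin F S
  have : IsArtinianRing R := IsArtinianRing.of_finite F R
  let I : Ideal R := Ideal.span {r : R | (r : Module.End F M) ∈ S}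
  obtain ⟨k, hk⟩ := IsArtinian.monotone_stabilizes
    (⟨fun k => OrderDual.toDual (I ^ k), fun _ _ h => Ideal.pow_le_pow_right h⟩ :
      ℕ →o (Ideal R)ᵒᵈ)
  replace hk : ∀ m, k ≤ m → I ^ k = I ^ m := hk
  -- A finitely generated idempotent ideal is generated by an idempotent. The exponent is `k + 1`
  -- because `k` may be `0`, and `e` must lie in `I`.
  have hidem : IsIdempotentElem (I ^ (k + 1)) := by
    change I ^ (k + 1) * I ^ (k + 1) = I ^ (k + 1)
    rw [← pow_add, ← hk (k + 1 + (k + 1)) (by omega), ← hk (k + 1) (by omega)]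
  obtain ⟨e, he, heI⟩ := (Ideal.isIdempotentElem_iff_of_fg _ (IsNoetherian.noetherian _)).1 hidem
  have heI' : e ∈ I := by
    have : e ∈ I ^ (k + 1) := heI ▸ Submodule.mem_span_singleton_self e
    exact Ideal.pow_le_self (by omega) this
  refine ⟨e, congrArg Subtype.val he, ?_, ⟨k + 1, ?_⟩, ?_, ?_⟩
  · intro f hf
    have : ∀ r ∈ Algebra.adjoin F S, Commute r f := by
      intro r hr
      induction hr using Algebra.adjoin_induction with
      | mem s hs => exact hf s hs
      | algebraMap a => exact Algebra.commute_algebraMap_left a f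
      | add a b _ _ ha hb => exact ha.add_left hb
      | mul a b _ _ ha hb => exact ha.mul_left hb
    exact this e e.2
  · intro s hs
    let s' : R := ⟨s, Algebra.subset_adjoin hs⟩
    have hsI : s' ∈ I := Ideal.subset_span (show s' ∈ {r : R | (r : Module.End F M) ∈ S} from hs)
    have hs' : s' ^ (k + 1) ∈ I ^ (k + 1) := Ideal.pow_mem_pow hsI _
    rw [heI] at hs'
    obtain ⟨a, ha⟩ := Submodule.mem_span_singleton.1 hs'
    have h0 : s' ^ (k + 1) * (1 - e) = 0 := by
      rw [← ha, smul_eq_mul, mul_assoc, mul_sub, mul_one, he.eq, sub_self, mul_zero]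
    exact congrArg Subtype.val h0
  · intro P hP
    refine Submodule.span_induction (p := fun (r : R) _ => ∀ m, (r : Module.End F M) m ∈ P)
      ?_ ?_ ?_ ?_ heI'
    · exact fun r hr m => hP r hr m
    · exact fun m => P.zero_mem
    · exact fun a b _ _ ha hb m => P.add_mem (ha m) (hb m)
    · intro a b _ hb m
      rw [smul_eq_mul, mul_comm]
      exact hb _
  · intro m hm
    refine Submodule.span_induction (p := fun (r : R) _ => (r : Module.End F M) m = 0)
      ?_ ?_ ?_ ?_ heI'
    · exact fun r hr => hm r hr
    · rfl
    · intro a b _ _ ha hb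
      change (a : Module.End F M) m + (b : Module.End F M) m = 0
      rw [ha, hb, add_zero]
    · intro a b _ hb
      change (a : Module.End F M) ((b : Module.End F M) m) = 0
      rw [hb, map_zero]

namespace Leibniz

variable {F L : Type*} [Field F] [LeibnizRing L] [LeibnizAlgebra F L]

/-! ### Right multiplications and their Fitting null-components -/

variable (F) in
/-- Right multiplication by `x`, a derivation. -/
def rightMul (x : L) : Module.End F L where
  toFun y := ⁅y, x⁆
  map_add' y z := LeibnizRing.add_bracket y z x
  map_smul' c y := LeibnizAlgebra.smul_bracket c y x

variable (F) in
/-- Left multiplication by `x`. -/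
def leftMul (x : L) : Module.End F L where
  toFun y := ⁅x, y⁆
  map_add' y z := LeibnizRing.bracket_add x y z
  map_smul' c y := LeibnizAlgebra.bracket_smul c x y

theorem rightMul_apply (x y : L) : rightMul F x y = ⁅y, x⁆ := rfl

theorem bracket_mem_product {U V : Submodule F L} {x y : L} (hx : x ∈ U) (hy : y ∈ V) :
    ⁅x, y⁆ ∈ product U V :=
  Submodule.subset_span ⟨x, hx, y, hy, rfl⟩

theorem product_le {U V P : Submodule F L} :
    product U V ≤ P ↔ ∀ x ∈ U, ∀ y ∈ V, ⁅x, y⁆ ∈ P := by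
  refine ⟨fun h x hx y hy => h (bracket_mem_product hx hy), fun h => Submodule.span_le.2 ?_⟩
  rintro _ ⟨x, hx, y, hy, rfl⟩
  exact h x hx y hy

/-- The Leibniz rule for the derivation `rightMul F x`: each application lowers one of the two
exponents. -/
theorem rightMul_pow_bracket (x : L) (i j : ℕ) (a b : L) (ha : (rightMul F x ^ i) a = 0)
    (hb : (rightMul F x ^ j) b = 0) : (rightMul F x ^ (i + j)) ⁅a, b⁆ = 0 := by
  induction hm : i + j generalizing i j a b with
  | zero =>
    obtain rfl : i = 0 := by omega
    have ha : a = 0 := ha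
    rw [ha, zero_bracket, map_zero]
  | succ m ih =>
    have hder : rightMul F x ⁅a, b⁆ = ⁅rightMul F x a, b⁆ + ⁅a, rightMul F x b⁆ := by
      simp only [rightMul_apply]
      rw [LeibnizRing.leibniz a b x]
      abel
    rw [pow_succ, Module.End.mul_apply, hder, map_add]
    have h1 : (rightMul F x ^ m) ⁅rightMul F x a, b⁆ = 0 := by
      rcases i with _ | i
      · have ha : a = 0 := ha
        rw [ha, map_zero, zero_bracket, map_zero]
      · exact ih i j _ b (by rwa [pow_succ, Module.End.mul_apply] at ha) hb (by omega)
    have h2 : (rightMul F x ^ m) ⁅a, rightMul F x b⁆ = 0 := by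
      rcases j with _ | j
      · have hb : b = 0 := hb
        rw [hb, map_zero, bracket_zero, map_zero]
      · exact ih i j a _ ha (by rwa [pow_succ, Module.End.mul_apply] at hb) (by omega)
    rw [h1, h2, add_zero]

theorem pow_apply_eq_zero_of_le {M : Type*} [AddCommGroup M] [Module F M] {f : Module.End F M}
    {i j : ℕ} (h : i ≤ j) {m : M} (hm : (f ^ i) m = 0) : (f ^ j) m = 0 := by
  rw [← Nat.sub_add_cancel h, pow_add, Module.End.mul_apply, hm, map_zero]

variable (F) in
/-- The Fitting null-component of right multiplication by `x`. -/
def nullComponent (x : L) : Submodule F L where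
  carrier := {y | ∃ k, (rightMul F x ^ k) y = 0}
  zero_mem' := ⟨0, rfl⟩
  add_mem' := by
    rintro a b ⟨i, hi⟩ ⟨j, hj⟩
    refine ⟨max i j, ?_⟩
    rw [map_add, pow_apply_eq_zero_of_le (le_max_left i j) hi,
      pow_apply_eq_zero_of_le (le_max_right i j) hj, add_zero]
  smul_mem' := by
    rintro c a ⟨i, hi⟩
    exact ⟨i, by rw [map_smul, hi, smul_zero]⟩

theorem isSubalgebra_nullComponent (x : L) : IsSubalgebra (nullComponent F x) := by
  rintro a ⟨i, hi⟩ b ⟨j, hj⟩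
  exact ⟨i + j, rightMul_pow_bracket x i j a b hi hj⟩

theorem coe_restrict_pow {U : Submodule F L} (f : Module.End F L) (hf : ∀ y ∈ U, f y ∈ U) (k : ℕ)
    (y : U) : (((f.restrict hf) ^ k) y : L) = (f ^ k) y := by
  induction k generalizing y with
  | zero => rfl
  | succ k ih => rw [pow_succ, pow_succ, Module.End.mul_apply, Module.End.mul_apply, ih]; rfl

/-- Fitting's lemma on `U`: kernel and range of a high power span `U`, and the range falls into `B`.
-/
theorem le_nullComponent_sup [FiniteDimensional F L] {U B : Submodule F L} {x : L}
    (hU : ∀ y ∈ U, ⁅y, x⁆ ∈ U) (hB : ∀ y ∈ B, ⁅y, x⁆ ∈ B)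
    (h : ∃ k, ∀ y ∈ U, (rightMul F x ^ k) y ∈ B) : U ≤ (U ⊓ nullComponent F x) ⊔ B := by
  obtain ⟨k, hk⟩ := h
  have hk' : ∀ m, k ≤ m → ∀ y ∈ U, (rightMul F x ^ m) y ∈ B := by
    intro m hm y hy
    induction m, hm using Nat.le_induction with
    | base => exact hk y hy
    | succ m _ ih => rw [pow_succ', Module.End.mul_apply]; exact hB _ ih
  let f : Module.End F U := (rightMul F x).restrict hU
  obtain ⟨m, hm, hkm⟩ :=
    (f.eventually_codisjoint_ker_pow_range_pow.and (Filter.eventually_ge_atTop k)).exists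
  intro y hy
  have hy' : (⟨y, hy⟩ : U) ∈ LinearMap.ker (f ^ m) ⊔ LinearMap.range (f ^ m) := by
    rw [hm.eq_top]; trivial
  obtain ⟨a, ha, _, ⟨b, rfl⟩, hab⟩ := Submodule.mem_sup.1 hy'
  have hab' : (a : L) + (rightMul F x ^ m) b = y := by
    rw [← coe_restrict_pow _ hU]
    exact congrArg Subtype.val hab
  rw [← hab']
  refine Submodule.add_mem_sup ⟨a.2, m, ?_⟩ (hk' m hkm b b.2)
  rw [← coe_restrict_pow _ hU]
  exact congrArg Subtype.val (LinearMap.mem_ker.1 ha)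

/-! ### Engel's theorem and nilpotent supplements -/

/-- Engel's theorem for right multiplications. -/
theorem isNilpotent_of_rightMul [FiniteDimensional F L] {U : Submodule F L} (hU : IsSubalgebra U)
    (h : ∀ x ∈ U, U ≤ nullComponent F x) : IsNilpotent U := by
  let _ : LieRing (Module.End F U) := LieRing.ofAssociativeRing
  -- The Leibniz identity says that right multiplications by `x` and `y` have commutator right
  -- multiplication by `⁅y, x⁆`. They form a Lie algebra acting on `U`, to which Engel's theorem for
  -- Lie modules applies.
  let 𝔤 : LieSubalgebra F (Module.End F U) :=
    { carrier := {f | ∃ x ∈ U, ∀ y : U, (f y : L) = ⁅(y : L), x⁆}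
      zero_mem' := ⟨0, U.zero_mem, fun y => (bracket_zero _).symm⟩
      add_mem' := by
        rintro f g ⟨x, hx, hf⟩ ⟨y, hy, hg⟩
        refine ⟨x + y, U.add_mem hx hy, fun z => ?_⟩
        rw [LeibnizRing.bracket_add, ← hf, ← hg]; rfl
      smul_mem' := by
        rintro c f ⟨x, hx, hf⟩
        refine ⟨c • x, U.smul_mem c hx, fun z => ?_⟩
        rw [LeibnizAlgebra.bracket_smul, ← hf]; rfl
      lie_mem' := by
        rintro f g ⟨x, hx, hf⟩ ⟨y, hy, hg⟩
        refine ⟨⁅y, x⁆, hU y hy x hx, fun z => ?_⟩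
        rw [LeibnizRing.leibniz, ← hf, ← hg, ← hf, ← hg]; rfl }
  have hnil : LieModule.IsNilpotent 𝔤 U := by
    rw [LieModule.isNilpotent_iff_forall (R := F)]
    rintro ⟨f, x, hx, hf⟩
    let g : Module.End F U := (rightMul F x).restrict fun y hy => hU y hy x hx
    have hfg : LieModule.toEnd F 𝔤 U ⟨f, x, hx, hf⟩ = g := by
      ext y
      exact hf y
    rw [hfg]
    obtain ⟨m, hm⟩ := (Filter.eventually_atTop.1 g.eventually_iSup_ker_pow_eq)
    refine ⟨m, LinearMap.ext fun y => ?_⟩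
    obtain ⟨k, hk⟩ := h x hx y.2
    have : y ∈ ⨆ k, LinearMap.ker (g ^ k) := by
      refine Submodule.mem_iSup_of_mem k (Subtype.ext ?_)
      exact (coe_restrict_pow _ _ k y).trans hk
    rw [hm m le_rfl] at this
    exact this
  obtain ⟨k, hk⟩ := (LieModule.isNilpotent_iff F 𝔤 U).1 hnil
  have key : ∀ k, ∀ z ∈ Leibniz.lowerCentralSeries U k,
      ∃ y ∈ LieModule.lowerCentralSeries F 𝔤 U k, (y : L) = z := by
    intro k
    induction k with
    | zero => exact fun z hz => ⟨⟨z, hz⟩, by simp, rfl⟩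
    | succ k ih =>
      suffices h : Leibniz.lowerCentralSeries U (k + 1) ≤
          (LieModule.lowerCentralSeries F 𝔤 U (k + 1)).toSubmodule.map U.subtype by
        intro z hz
        obtain ⟨y, hy, hyz⟩ := h hz
        exact ⟨y, hy, hyz⟩
      refine product_le.2 fun a ha b hb => ?_
      obtain ⟨y, hy, rfl⟩ := ih a ha
      let g : 𝔤 := ⟨(rightMul F b).restrict fun y hy => hU y hy b hb, b, hb, fun _ => rfl⟩
      refine ⟨⁅g, y⁆, ?_, rfl⟩
      rw [LieModule.lowerCentralSeries_succ]
      exact LieSubmodule.lie_mem_lie (LieSubmodule.mem_top g) hy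
  refine ⟨k, (Submodule.eq_bot_iff _).2 fun z hz => ?_⟩
  obtain ⟨y, hy, rfl⟩ := key k z hz
  rw [hk] at hy
  rw [(LieSubmodule.mem_bot y).1 hy]; rfl

/-- A nilpotent quotient lifts to a nilpotent subalgebra. -/
theorem exists_nilpotent_supplement [FiniteDimensional F L] {U B : Submodule F L}
    (hU : IsSubalgebra U) (hB : ∀ b ∈ B, ∀ u ∈ U, ⁅b, u⁆ ∈ B)
    (h : ∀ x ∈ U, ∃ k, ∀ y ∈ U, (rightMul F x ^ k) y ∈ B) :
    ∃ C ≤ U, IsSubalgebra C ∧ IsNilpotent C ∧ U ≤ C ⊔ B := by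
  obtain ⟨C, hCU, ⟨hC, hCB⟩, hmin⟩ := exists_minimal_le_of_wellFoundedLT
    (fun C : Submodule F L => IsSubalgebra C ∧ U ≤ C ⊔ B) U ⟨hU, le_sup_left⟩
  refine ⟨C, hCU, hC, isNilpotent_of_rightMul hC fun x hx => ?_, hCB⟩
  -- Thus `C ⊓ nullComponent F x` is still a supplement, and minimality of `C` makes it all of `C`.
  have hle : C ≤ (C ⊓ nullComponent F x) ⊔ B := by
    obtain ⟨k, hk⟩ := h x (hCU hx)
    exact le_nullComponent_sup (fun y hy => hC y hy x hx) (fun b hb => hB b hb x (hCU hx))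
      ⟨k, fun y hy => hk y (hCU hy)⟩
  refine (hmin ⟨fun a ha b hb => Submodule.mem_inf.2
    ⟨hC a ha.1 b hb.1, isSubalgebra_nullComponent x a ha.2 b hb.2⟩,
    hCB.trans (sup_le hle le_sup_right)⟩ inf_le_left).trans inf_le_right

/-- Modulo `B`, every element of `U` is represented in a nilpotent, hence abelian, subalgebra. -/
theorem IsAAlgebra.product_le_of_rightMul [FiniteDimensional F L] (hA : IsAAlgebra F L)
    {U B : Submodule F L} (hU : IsSubalgebra U)
    (hB : ∀ b ∈ B, ∀ u ∈ U, ⁅b, u⁆ ∈ B ∧ ⁅u, b⁆ ∈ B)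
    (h : ∀ x ∈ U, ∃ k, ∀ y ∈ U, (rightMul F x ^ k) y ∈ B) : product U U ≤ B := by
  obtain ⟨C, hCU, hC, hCnil, hCB⟩ :=
    exists_nilpotent_supplement hU (fun b hb u hu => (hB b hb u hu).1) h
  refine product_le.2 fun x hx y hy => ?_
  obtain ⟨c, hc, b, hb, rfl⟩ := Submodule.mem_sup.1 (hCB hx)
  obtain ⟨c', hc', b', hb', rfl⟩ := Submodule.mem_sup.1 (hCB hy)
  rw [LeibnizRing.add_bracket, LeibnizRing.bracket_add, hA C hC hCnil c hc c' hc', zero_add]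
  exact B.add_mem (hB b' hb' c (hCU hc)).2 (hB b hb _ hy).1

/-! ### Fitting decompositions and metabelian subalgebras -/

/-- Fitting decomposition of `C` under right multiplications by `V`, when `[V, V]` acts trivially
on `C`. -/
theorem exists_fitting_decomposition [FiniteDimensional F L] {C V : Submodule F L}
    (hC : ∀ c ∈ C, ∀ v ∈ V, ⁅c, v⁆ ∈ C ∧ ⁅v, c⁆ ∈ C)
    (hV : ∀ c ∈ C, ∀ x ∈ V, ∀ y ∈ V, ⁅c, ⁅x, y⁆⁆ = 0 ∧ ⁅⁅x, y⁆, c⁆ = 0) :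
    ∃ C₀ C₁ : Submodule F L, C₀ ⊔ C₁ = C ∧ Disjoint C₀ C₁ ∧
      (∀ c ∈ C₀, ∀ v ∈ V, ⁅c, v⁆ ∈ C₀ ∧ ⁅v, c⁆ ∈ C₀) ∧
      (∀ c ∈ C₁, ∀ v ∈ V, ⁅c, v⁆ ∈ C₁ ∧ ⁅v, c⁆ ∈ C₁) ∧
      (∀ v ∈ V, ∃ k, ∀ c ∈ C₀, (rightMul F v ^ k) c = 0) ∧
      C₁ ≤ product C V ∧
      (∀ c ∈ C, (∀ v ∈ V, ⁅c, v⁆ = 0) → c ∈ C₀) := by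
  let r (v : V) : Module.End F C := (rightMul F (v : L)).restrict fun c hc => (hC c hc v v.2).1
  let l (v : V) : Module.End F C := (leftMul F (v : L)).restrict fun c hc => (hC c hc v v.2).2
  -- The two halves of `hV` make the right multiplications commute with each other and with the left
  -- ones, so `e` commutes with both kinds and its kernel and range are stable.
  have hrr (v w : V) : Commute (r v) (r w) := by
    refine LinearMap.ext fun c => Subtype.ext ?_
    change ⁅⁅(c : L), (w : L)⁆, (v : L)⁆ = ⁅⁅(c : L), (v : L)⁆, (w : L)⁆
    have h := (hV c c.2 v v.2 w w.2).1
    rw [LeibnizRing.leibniz] at h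
    exact (sub_eq_zero.1 h).symm
  have hrl (v w : V) : Commute (r v) (l w) := by
    refine LinearMap.ext fun c => Subtype.ext ?_
    change ⁅⁅(w : L), (c : L)⁆, (v : L)⁆ = ⁅(w : L), ⁅(c : L), (v : L)⁆⁆
    rw [LeibnizRing.leibniz, (hV c c.2 w w.2 v v.2).2, sub_zero]
  obtain ⟨e, he, hcomm, ⟨k, hk⟩, hrange, hker⟩ :=
    Module.End.exists_fitting_idempotent (Set.range r)
      (by rintro _ ⟨v, rfl⟩ _ ⟨w, rfl⟩; exact hrr v w)
  have her (v : V) : Commute e (r v) :=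
    hcomm _ (by rintro _ ⟨w, rfl⟩; exact hrr w v)
  have hel (v : V) : Commute e (l v) :=
    hcomm _ (by rintro _ ⟨w, rfl⟩; exact hrl w v)
  have hee (c : C) : e (e c) = e c := LinearMap.congr_fun he c
  have hstable₀ (f : Module.End F C) (hf : Commute e f) (c : C) (hc : e c = 0) : e (f c) = 0 := by
    rw [← Module.End.mul_apply, hf.eq, Module.End.mul_apply, hc, map_zero]
  have hstable₁ (f : Module.End F C) (hf : Commute e f) (c : C) : f (e c) = e (f c) := by
    rw [← Module.End.mul_apply, ← hf.eq, Module.End.mul_apply]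
  refine ⟨(LinearMap.ker e).map C.subtype, (LinearMap.range e).map C.subtype, ?_, ?_, ?_, ?_, ?_,
    ?_, ?_⟩
  · refine le_antisymm (sup_le (Submodule.map_subtype_le _ _) (Submodule.map_subtype_le _ _)) ?_
    intro c hc
    refine Submodule.mem_sup.2 ⟨_, ⟨⟨c, hc⟩ - e ⟨c, hc⟩, ?_, rfl⟩, _, ⟨e ⟨c, hc⟩, ⟨_, rfl⟩, rfl⟩, ?_⟩
    · change e _ = 0
      rw [map_sub, hee, sub_self]
    · simp
  · rw [Submodule.disjoint_def]
    rintro _ ⟨c, hc, rfl⟩ ⟨_, ⟨d, rfl⟩, hd⟩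
    have hcd : e d = c := Subtype.ext hd
    have hc : e c = 0 := hc
    rw [← hcd, hee] at hc
    rw [← hcd, hc, map_zero]
  · rintro _ ⟨c, hc, rfl⟩ v hv
    exact ⟨⟨r ⟨v, hv⟩ c, hstable₀ _ (her _) c hc, rfl⟩, ⟨l ⟨v, hv⟩ c, hstable₀ _ (hel _) c hc, rfl⟩⟩
  · rintro _ ⟨_, ⟨c, rfl⟩, rfl⟩ v hv
    exact ⟨⟨r ⟨v, hv⟩ (e c), ⟨_, (hstable₁ _ (her _) c).symm⟩, rfl⟩,
      ⟨l ⟨v, hv⟩ (e c), ⟨_, (hstable₁ _ (hel _) c).symm⟩, rfl⟩⟩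
  · intro v hv
    refine ⟨k, ?_⟩
    rintro _ ⟨c, hc, rfl⟩
    have h := LinearMap.congr_fun (hk _ ⟨⟨v, hv⟩, rfl⟩) c
    have hc : e c = 0 := hc
    rw [Module.End.mul_apply, LinearMap.sub_apply, hc, sub_zero] at h
    refine (coe_restrict_pow _ (fun c hc => (hC c hc v hv).1) k c).symm.trans ?_
    exact congrArg Subtype.val h
  · rintro _ ⟨_, ⟨c, rfl⟩, rfl⟩
    refine hrange ((product C V).comap C.subtype) ?_ c
    rintro _ ⟨v, rfl⟩ m
    exact bracket_mem_product m.2 v.2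
  · intro c hc h
    refine ⟨⟨c, hc⟩, hker _ ?_, rfl⟩
    rintro _ ⟨v, rfl⟩
    exact Subtype.ext (h v v.2)

/-- In a metabelian subalgebra of an `A`-algebra, no nonzero element of the derived algebra is
annihilated by all right multiplications. -/
theorem IsAAlgebra.eq_zero_of_mem_product [FiniteDimensional F L] (hA : IsAAlgebra F L)
    {V : Submodule F L} (hV : IsSubalgebra V) (hab : IsAbelian (product V V)) {a : L}
    (ha : a ∈ product V V) (h : ∀ v ∈ V, ⁅a, v⁆ = 0) : a = 0 := by
  have hle : product V V ≤ V := product_le.2 hV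
  obtain ⟨C₀, C₁, hsup, hdisj, -, h₁, hnil, -, hmem⟩ :=
    exists_fitting_decomposition (C := product V V) (V := V)
      (fun c hc v hv => ⟨bracket_mem_product (hle hc) hv, bracket_mem_product hv (hle hc)⟩)
      (fun c hc x hx y hy => ⟨hab c hc _ (bracket_mem_product hx hy),
        hab _ (bracket_mem_product hx hy) c hc⟩)
  have hC₁ : product V V ≤ C₁ := by
    refine hA.product_le_of_rightMul hV h₁ fun x hx => ?_
    obtain ⟨k, hk⟩ := hnil x hx
    -- One multiplication to enter `[V, V] = C₀ ⊔ C₁`, then `k` more to kill the `C₀` part.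
    refine ⟨k + 1, fun y hy => ?_⟩
    have hyx : ⁅y, x⁆ ∈ C₀ ⊔ C₁ := hsup ▸ bracket_mem_product hy hx
    obtain ⟨c, hc, d, hd, hcd⟩ := Submodule.mem_sup.1 hyx
    rw [pow_succ, Module.End.mul_apply, rightMul_apply, ← hcd, map_add, hk c hc, zero_add]
    exact Module.End.pow_apply_mem_of_forall_mem (p := C₁) k (fun z hz => (h₁ z hz x hx).1) d hd
  exact Submodule.disjoint_def.1 hdisj a (hmem a ha h) (hC₁ ha)

/-! ### Ideals, the derived series and abelian ideals -/

theorem IsIdeal.isSubalgebra {I : Submodule F L} (hI : IsIdeal I) : IsSubalgebra I :=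
  fun x hx y _ => (hI x hx y).1

theorem IsIdeal.product_self {I : Submodule F L} (hI : IsIdeal I) : IsIdeal (product I I) := by
  intro x hx y
  have hr : product I I ≤ (product I I).comap (rightMul F y) := by
    refine product_le.2 fun a ha b hb => ?_
    have h : ⁅⁅a, b⁆, y⁆ = ⁅a, ⁅b, y⁆⁆ + ⁅⁅a, y⁆, b⁆ := by rw [LeibnizRing.leibniz]; abel
    rw [Submodule.mem_comap, rightMul_apply, h]
    exact add_mem (bracket_mem_product ha (hI b hb y).1) (bracket_mem_product (hI a ha y).1 hb)
  have hl : product I I ≤ (product I I).comap (leftMul F y) := by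
    refine product_le.2 fun a ha b hb => ?_
    change ⁅y, ⁅a, b⁆⁆ ∈ product I I
    rw [LeibnizRing.leibniz]
    exact sub_mem (bracket_mem_product (hI a ha y).2 hb) (bracket_mem_product (hI b hb y).2 ha)
  exact ⟨hr hx, hl hx⟩

theorem IsIdeal.centralizer {I : Submodule F L} (hI : IsIdeal I) :
    IsIdeal (Leibniz.centralizer I) := by
  intro x hx y
  constructor <;> intro v hv
  · have h1 : ⁅⁅x, y⁆, v⁆ = ⁅x, ⁅y, v⁆⁆ + ⁅⁅x, v⁆, y⁆ := by rw [LeibnizRing.leibniz]; abel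
    rw [h1, LeibnizRing.leibniz v x y, (hx _ (hI v hv y).2).1, (hx v hv).1, (hx v hv).2,
      (hx _ (hI v hv y).1).2, zero_bracket]
    simp
  · have h1 : ⁅⁅y, x⁆, v⁆ = ⁅y, ⁅x, v⁆⁆ + ⁅⁅y, v⁆, x⁆ := by rw [LeibnizRing.leibniz]; abel
    rw [h1, LeibnizRing.leibniz v y x, (hx _ (hI v hv y).2).2, (hx v hv).1, (hx v hv).2,
      (hx _ (hI v hv y).1).2, zero_bracket, bracket_zero]
    simp

theorem isIdeal_derivedSeries (k : ℕ) : IsIdeal (derivedSeries F L k) := by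
  induction k with
  | zero => exact fun _ _ _ => ⟨trivial, trivial⟩
  | succ k ih => exact ih.product_self

theorem product_mono {U V U' V' : Submodule F L} (hU : U ≤ U') (hV : V ≤ V') :
    product U V ≤ product U' V' :=
  product_le.2 fun _ hx _ hy => bracket_mem_product (hU hx) (hV hy)

theorem product_self_eq_bot {U : Submodule F L} : product U U = ⊥ ↔ IsAbelian U := by
  rw [eq_bot_iff, product_le]; rfl

theorem IsAbelian.isNilpotent {U : Submodule F L} (hU : IsAbelian U) : IsNilpotent U :=
  ⟨1, product_self_eq_bot.2 hU⟩

theorem IsMonolith.le [FiniteDimensional F L] {W I : Submodule F L} (hW : IsMonolith W)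
    (hI : IsIdeal I) (h : I ≠ ⊥) : W ≤ I := by
  obtain ⟨J, hJI, hJ⟩ := exists_minimal_le_of_wellFoundedLT
    (fun J : Submodule F L => IsIdeal J ∧ J ≠ ⊥) I ⟨hI, h⟩
  exact hW.2 J hJ ▸ hJI

/-- A nonabelian ideal of a solvable Leibniz algebra contains a metabelian nonabelian ideal. -/
theorem exists_metabelian_ideal {m : ℕ} (hm : derivedSeries F L m = ⊥) {I : Submodule F L}
    (hI : IsIdeal I) (hna : ¬ IsAbelian I) :
    ∃ V ≤ I, IsIdeal V ∧ ¬ IsAbelian V ∧ IsAbelian (product V V) := by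
  by_contra hcon
  push Not at hcon
  -- Without such an ideal, squaring keeps producing nonabelian ideals ever deeper in the derived
  -- series.
  have key : ∀ k, ∃ V ≤ I, V ≤ derivedSeries F L k ∧ IsIdeal V ∧ ¬ IsAbelian V := by
    intro k
    induction k with
    | zero => exact ⟨I, le_rfl, le_top, hI, hna⟩
    | succ k ih =>
      obtain ⟨V, hVI, hVk, hV, hVna⟩ := ih
      exact ⟨product V V, (product_le.2 hV.isSubalgebra).trans hVI, product_mono hVk hVk,
        hV.product_self, hcon V hVI hV hVna⟩
  obtain ⟨V, -, hVm, -, hVna⟩ := key m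
  rw [hm, le_bot_iff] at hVm
  subst hVm
  refine hVna fun x hx y _ => ?_
  rw [(Submodule.mem_bot F).1 hx, zero_bracket]

/-- In an `A`-algebra, an abelian ideal `C` meeting the centralizer of an ideal `V` trivially
satisfies `C ≤ [C, V]`, provided that `[V, V] ≤ C`. -/
theorem IsAAlgebra.le_product_of_disjoint_centralizer [FiniteDimensional F L]
    (hA : IsAAlgebra F L) {C V : Submodule F L} (hC : IsIdeal C) (hCab : IsAbelian C)
    (hV : IsIdeal V) (hVC : product V V ≤ C) (h : Disjoint C (centralizer V)) :
    C ≤ product C V := by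
  obtain ⟨C₀, C₁, hsup, hdisj, h₀, h₁, hnil, hprod, hmem⟩ :=
    exists_fitting_decomposition (C := C) (V := V) (fun c hc v _ => hC c hc v)
      (fun c hc x hx y hy => ⟨hCab c hc _ (hVC (bracket_mem_product hx hy)),
        hCab _ (hVC (bracket_mem_product hx hy)) c hc⟩)
  have hC₀ : C₀ ≤ C := hsup ▸ le_sup_left
  obtain ⟨H, hHV, hH, hHnil, hHsup⟩ := exists_nilpotent_supplement (U := V) (B := product V V)
    hV.isSubalgebra (fun b hb u _ => (hV.product_self b hb u).1)
    (fun x hx => ⟨1, fun y hy => bracket_mem_product hy hx⟩)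
  have hHab := hA H hH hHnil
  have hX : ∀ x ∈ C₀ ⊔ H, ∀ y ∈ C₀ ⊔ H, ⁅x, y⁆ ∈ C₀ := by
    intro x hx y hy
    obtain ⟨c, hc, u, hu, rfl⟩ := Submodule.mem_sup.1 hx
    obtain ⟨d, hd, w, hw, rfl⟩ := Submodule.mem_sup.1 hy
    rw [LeibnizRing.add_bracket, LeibnizRing.bracket_add, LeibnizRing.bracket_add,
      hCab c (hC₀ hc) d (hC₀ hd), hHab u hu w hw]
    simpa using add_mem (h₀ c hc w (hHV hw)).1 (h₀ d hd u (hHV hu)).2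
  have hXsub : IsSubalgebra (C₀ ⊔ H) := fun x hx y hy => (le_sup_left : C₀ ≤ C₀ ⊔ H) (hX x hx y hy)
  -- Products land in `C₀`, where `c + u` acts as `u` does, nilpotently. So Engel's theorem and the
  -- `A`-property apply. It follows that `C₀` centralizes `H` and `[V, V]`, hence `V`.
  have hXab : IsAbelian (C₀ ⊔ H) := by
    refine hA _ hXsub (isNilpotent_of_rightMul hXsub fun x hx y hy => ?_)
    obtain ⟨c, hc, u, hu, rfl⟩ := Submodule.mem_sup.1 hx
    obtain ⟨k, hk⟩ := hnil u (hHV hu)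
    have hagree : ∀ j, ∀ d ∈ C₀, (rightMul F (c + u) ^ j) d = (rightMul F u ^ j) d := by
      intro j
      induction j with
      | zero => exact fun _ _ => rfl
      | succ j ih =>
        intro d hd
        have hd' : rightMul F (c + u) d = rightMul F u d := by
          rw [rightMul_apply, rightMul_apply, LeibnizRing.bracket_add,
            hCab d (hC₀ hd) c (hC₀ hc), zero_add]
        rw [pow_succ, pow_succ, Module.End.mul_apply, Module.End.mul_apply, hd']
        exact ih _ (h₀ d hd u (hHV hu)).1
    refine ⟨k + 1, ?_⟩
    have hyx := hX y hy _ hx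
    rw [pow_succ, Module.End.mul_apply, rightMul_apply, hagree k _ hyx, hk _ hyx]
  have hC₀bot : C₀ = ⊥ := by
    refine (Submodule.eq_bot_iff _).2 fun c hc => Submodule.disjoint_def.1 h c (hC₀ hc) ?_
    intro v hv
    obtain ⟨u, hu, b, hb, rfl⟩ := Submodule.mem_sup.1 (hHsup hv)
    have hcX : c ∈ C₀ ⊔ H := (le_sup_left : C₀ ≤ C₀ ⊔ H) hc
    have huX : u ∈ C₀ ⊔ H := (le_sup_right : H ≤ C₀ ⊔ H) hu
    rw [LeibnizRing.bracket_add, LeibnizRing.add_bracket, hXab c hcX u huX, hXab u huX c hcX,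
      hCab c (hC₀ hc) b (hVC hb), hCab b (hVC hb) c (hC₀ hc), add_zero]
    exact ⟨rfl, rfl⟩
  rw [hC₀bot, bot_sup_eq] at hsup
  exact hsup ▸ hprod

theorem derivedSeries_last_ne_bot {n : ℕ} (hn : IsSolvableOfDerivedLength F L (n + 1)) :
    derivedSeries F L n ≠ ⊥ := fun h => absurd (hn.2 h) (by omega)

theorem isAbelian_derivedSeries_last {n : ℕ} (hn : IsSolvableOfDerivedLength F L (n + 1)) :
    IsAbelian (derivedSeries F L n) :=
  product_self_eq_bot.1 hn.1

/-! ### Monolithic algebras -/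

section Monolithic

variable [FiniteDimensional F L] {n : ℕ} {W : Submodule F L}

theorem IsMonolith.isAbelian (hn : IsSolvableOfDerivedLength F L (n + 1)) (hW : IsMonolith W) :
    IsAbelian W := by
  by_contra hna
  have hIW := hW.1.1.1
  obtain ⟨V, hVW, hV, hVna, hVab⟩ := exists_metabelian_ideal hn.1 hIW hna
  have hne : product V V ≠ ⊥ := fun h => hVna (product_self_eq_bot.1 h)
  have hle := hW.le hV.product_self hne
  exact hVna fun x hx y hy => hVab x (hle (hVW hx)) y (hle (hVW hy))

theorem IsMonolith.isAbelian_centralizer (hA : IsAAlgebra F L)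
    (hn : IsSolvableOfDerivedLength F L (n + 1)) (hW : IsMonolith W) :
    IsAbelian (centralizer W) := by
  by_contra hna
  obtain ⟨V, hVC, hV, hVna, hVab⟩ := exists_metabelian_ideal hn.1 hW.1.1.1.centralizer hna
  have hle := hW.le hV.product_self fun h => hVna (product_self_eq_bot.1 h)
  exact hW.1.1.2 <| (Submodule.eq_bot_iff _).2 fun w hw =>
    hA.eq_zero_of_mem_product hV.isSubalgebra hVab (hle hw) fun v hv => (hVC hv w hw).2

theorem IsMonolith.centralizer_derivedSeries_eq_bot (hA : IsAAlgebra F L)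
    (hn : IsSolvableOfDerivedLength F L (n + 1 + 1)) (hW : IsMonolith W) :
    centralizer (derivedSeries F L n) = ⊥ := by
  by_contra hne
  have h1 := hW.le (isIdeal_derivedSeries n).centralizer hne
  have h2 := hW.le (isIdeal_derivedSeries (n + 1)) (derivedSeries_last_ne_bot hn)
  exact hW.1.1.2 <| (Submodule.eq_bot_iff _).2 fun w hw =>
    hA.eq_zero_of_mem_product (isIdeal_derivedSeries n).isSubalgebra
      (isAbelian_derivedSeries_last hn) (h2 hw) fun v hv => (h1 hw v hv).1

/-- With `V` the penultimate derived term and `C` the centralizer of `W`, `C ≤ [C, V]` is used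
twice: first it gives `C ≤ V`, then `C ≤ [V, V]`. -/
theorem IsMonolith.centralizer_eq (hA : IsAAlgebra F L)
    (hn : IsSolvableOfDerivedLength F L (n + 1)) (hW : IsMonolith W) :
    centralizer W = derivedSeries F L n := by
  have hle := hW.le (isIdeal_derivedSeries n) (derivedSeries_last_ne_bot hn)
  have hge : derivedSeries F L n ≤ centralizer W := fun x hx w hw =>
    ⟨isAbelian_derivedSeries_last hn x hx w (hle hw),
      isAbelian_derivedSeries_last hn w (hle hw) x hx⟩
  refine le_antisymm ?_ hge
  rcases n with _ | n
  · exact le_top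
  have hC := hW.1.1.1.centralizer
  have hprod := hA.le_product_of_disjoint_centralizer hC (hW.isAbelian_centralizer hA hn)
    (isIdeal_derivedSeries n) hge (by rw [hW.centralizer_derivedSeries_eq_bot hA hn]; exact disjoint_bot_right)
  have hCV : centralizer W ≤ derivedSeries F L n :=
    hprod.trans (product_le.2 fun c _ v hv => (isIdeal_derivedSeries n v hv c).2)
  exact hprod.trans (product_mono hCV le_rfl)

theorem IsMonolith.isGreatest_derivedSeries (hA : IsAAlgebra F L)
    (hn : IsSolvableOfDerivedLength F L (n + 1)) (hW : IsMonolith W) :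
    IsGreatest (nilpotentIdeals F L) (derivedSeries F L n) := by
  refine ⟨⟨isIdeal_derivedSeries n, (isAbelian_derivedSeries_last hn).isNilpotent⟩, ?_⟩
  rintro I ⟨hI, hnil⟩
  rw [← hW.centralizer_eq hA hn]
  rcases eq_or_ne I ⊥ with rfl | hne
  · exact bot_le
  have hab := hA I hI.isSubalgebra hnil
  have hle := hW.le hI hne
  exact fun x hx w hw => ⟨hab x hx w (hle hw), hab w (hle hw) x hx⟩

theorem IsMonolith.center_eq_bot (hA : IsAAlgebra F L)
    (hn : IsSolvableOfDerivedLength F L (n + 1 + 1)) (hW : IsMonolith W) : center F L = ⊥ := by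
  rw [eq_bot_iff, ← hW.centralizer_derivedSeries_eq_bot hA hn]
  exact fun x hx v _ => hx v trivial

/-- `[W, L]` is nonzero because the penultimate derived term cannot annihilate `W`; by minimality it
remains to see that it is an ideal. -/
theorem IsMonolith.product_top_eq (hA : IsAAlgebra F L)
    (hn : IsSolvableOfDerivedLength F L (n + 1 + 1)) (hW : IsMonolith W) :
    product W ⊤ = W := by
  have hIW := hW.1.1.1
  have hle : product W ⊤ ≤ W := product_le.2 fun w hw x _ => (hIW w hw x).1
  have hne : product W ⊤ ≠ ⊥ := by
    intro h
    have h2 := hW.le (isIdeal_derivedSeries (n + 1)) (derivedSeries_last_ne_bot hn)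
    refine hW.1.1.2 <| (Submodule.eq_bot_iff _).2 fun w hw =>
      hA.eq_zero_of_mem_product (isIdeal_derivedSeries n).isSubalgebra
        (isAbelian_derivedSeries_last hn) (h2 hw) fun v _ => ?_
    exact (Submodule.eq_bot_iff _).1 h _ (bracket_mem_product hw trivial)
  refine le_antisymm hle (hW.le ?_ hne)
  have hleft : ∀ w ∈ W, ∀ y : L, ⁅y, w⁆ ∈ product W ⊤ := by
    -- `J` is an ideal inside `W` containing all `⁅y, w⁆ + ⁅w, y⁆`. If `J = ⊥` the bracket with `W`
    -- is skew; otherwise `W ≤ J` and left multiplications kill `W`.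
    let J : Submodule F L :=
      { carrier := {w | w ∈ W ∧ ∀ x : L, ⁅x, w⁆ = 0}
        zero_mem' := ⟨W.zero_mem, bracket_zero⟩
        add_mem' := fun ha hb => ⟨W.add_mem ha.1 hb.1, fun x => by
          rw [LeibnizRing.bracket_add, ha.2, hb.2, add_zero]⟩
        smul_mem' := fun c a ha => ⟨W.smul_mem c ha.1, fun x => by
          rw [LeibnizAlgebra.bracket_smul, ha.2, smul_zero]⟩ }
    have hJ : IsIdeal J := by
      rintro w ⟨hw, h0⟩ y
      refine ⟨⟨(hIW w hw y).1, fun x => ?_⟩, ?_⟩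
      · rw [LeibnizRing.leibniz, h0, h0, zero_bracket, sub_zero]
      · rw [h0]; exact J.zero_mem
    by_cases hJ0 : J = ⊥
    · intro w hw y
      have hmem : ⁅y, w⁆ + ⁅w, y⁆ ∈ J := by
        refine ⟨W.add_mem (hIW w hw y).2 (hIW w hw y).1, fun x => ?_⟩
        rw [LeibnizRing.bracket_add, LeibnizRing.leibniz, LeibnizRing.leibniz]
        abel
      rw [hJ0, Submodule.mem_bot] at hmem
      rw [eq_neg_of_add_eq_zero_left hmem]
      exact neg_mem (bracket_mem_product hw trivial)
    · intro w hw y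
      rw [(hW.le hJ hJ0 hw).2 y]
      exact zero_mem _
  exact fun w hw y => ⟨bracket_mem_product (hle hw) trivial, hleft w (hle hw) y⟩

theorem IsMonolith.isPhiFree_iff (hA : IsAAlgebra F L)
    (hn : IsSolvableOfDerivedLength F L (n + 1)) (hW : IsMonolith W) :
    IsPhiFree F L ↔ W = derivedSeries F L n := by
  have hIW := hW.1.1.1
  have hIN := isIdeal_derivedSeries (F := F) (L := L) n
  have hNab := isAbelian_derivedSeries_last hn
  have hle := hW.le hIN (derivedSeries_last_ne_bot hn)
  have hphi : IsPhiFree F L ↔ ∃ M : Submodule F L, IsMaximalSubalgebra M ∧ ¬ W ≤ M := by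
    have hgr := isGreatest_frattini F L
    constructor
    · intro h
      by_contra! hcon
      have h1 : W ≤ frattini F L := hgr.2 ⟨hIW, hcon⟩
      exact hW.1.1.2 (eq_bot_iff.2 (h ▸ h1))
    · rintro ⟨M, hM, hWM⟩
      by_contra hne
      exact hWM ((hW.le hgr.1.1 hne).trans (hgr.1.2 M hM))
  rw [hphi]
  constructor
  · rintro ⟨M, hM, hWM⟩
    have htop : W ⊔ M = ⊤ := by
      by_contra hne
      have hsub : IsSubalgebra (W ⊔ M) := by
        intro x hx y hy
        obtain ⟨w, hw, m, hm, rfl⟩ := Submodule.mem_sup.1 hx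
        obtain ⟨w', hw', m', hm', rfl⟩ := Submodule.mem_sup.1 hy
        rw [LeibnizRing.add_bracket, LeibnizRing.bracket_add m]
        rw [← add_assoc]
        exact Submodule.add_mem_sup (add_mem (hIW w hw _).1 (hIW w' hw' m).2)
          (hM.1.1 m hm m' hm')
      exact hWM (le_sup_left.trans (hM.2 ⟨hsub, hne⟩ le_sup_right))
    -- As `L = W + M` and `W` acts trivially on the abelian last term, only brackets with `M`
    -- matter.
    have hideal : IsIdeal (derivedSeries F L n ⊓ M) := by
      rintro x ⟨hxN, hxM⟩ y
      have hy : y ∈ W ⊔ M := htop ▸ trivial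
      obtain ⟨w, hw, m, hm, rfl⟩ := Submodule.mem_sup.1 hy
      rw [LeibnizRing.bracket_add, LeibnizRing.add_bracket, hNab x hxN w (hle hw),
        hNab w (hle hw) x hxN, zero_add, zero_add]
      exact ⟨⟨(hIN x hxN m).1, hM.1.1 x hxM m hm⟩, ⟨(hIN x hxN m).2, hM.1.1 m hm x hxM⟩⟩
    have hbot : derivedSeries F L n ⊓ M = ⊥ := by
      by_contra hne
      exact hWM ((hW.le hideal hne).trans inf_le_right)
    refine le_antisymm hle fun x hx => ?_
    have hx' : x ∈ W ⊔ M := htop ▸ trivial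
    obtain ⟨w, hw, m, hm, rfl⟩ := Submodule.mem_sup.1 hx'
    have hm' : m ∈ derivedSeries F L n ⊓ M := by
      refine ⟨?_, hm⟩
      simpa using sub_mem hx (hle hw)
    rw [hbot, Submodule.mem_bot] at hm'
    rwa [hm', add_zero]
  · intro hWN
    suffices h : ∃ E : Submodule F L, IsSubalgebra E ∧ E ≠ ⊤ ∧ ⊤ ≤ E ⊔ W by
      obtain ⟨E, hE, hEne, hEW⟩ := h
      obtain ⟨M, hEM, hM⟩ := exists_maximal_ge_of_wellFoundedGT
        (fun U : Submodule F L => IsSubalgebra U ∧ U ≠ ⊤) E ⟨hE, hEne⟩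
      exact ⟨M, hM, fun h => hM.1.2 (top_le_iff.1 (hEW.trans (sup_le hEM h)))⟩
    rcases n with _ | n
    · refine ⟨⊥, fun x hx y _ => ?_, fun h => hW.1.1.2 ?_, ?_⟩
      · rw [(Submodule.mem_bot F).1 hx, zero_bracket]; exact zero_mem _
      · rw [eq_bot_iff, h]; exact le_top
      · rw [hWN]; exact le_sup_right
    · have hV := isIdeal_derivedSeries (F := F) (L := L) n
      -- Otherwise this term would be nilpotent by Engel's theorem, hence abelian, and the next one
      -- zero.
      obtain ⟨v, hv, hne⟩ : ∃ v ∈ derivedSeries F L n, nullComponent F v ≠ ⊤ := by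
        by_contra! hcon
        have hnil := isNilpotent_of_rightMul hV.isSubalgebra fun x hx => hcon x hx ▸ le_top
        exact derivedSeries_last_ne_bot hn
          (product_self_eq_bot.2 (hA _ hV.isSubalgebra hnil))
      refine ⟨nullComponent F v, isSubalgebra_nullComponent v, hne, ?_⟩
      -- Exponent `2`: `⁅y, v⁆` lies in the penultimate term, so `⁅⁅y, v⁆, v⁆` lies in the last one,
      -- which is `W`.
      have h := le_nullComponent_sup (F := F) (U := ⊤) (B := W) (x := v) (fun _ _ => trivial)
        (fun y hy => (hIW y hy v).1) ⟨2, fun y _ => ?_⟩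
      · simpa using h
      · rw [hWN, pow_two]
        exact bracket_mem_product (hV v hv y).2 hv

end Monolithic

end Leibniz

theorem theorem5p1 {F L : Type*} [Field F] [LeibnizRing L] [LeibnizAlgebra F L]
    [FiniteDimensional F L] (hA : Leibniz.IsAAlgebra F L)
    (n : ℕ) (hn : Leibniz.IsSolvableOfDerivedLength F L (n + 1))
    (W : Submodule F L) (hW : Leibniz.IsMonolith W) :
    Leibniz.IsAbelian W ∧
    (1 ≤ n → Leibniz.center F L = ⊥ ∧
      (Leibniz.product ⊤ W = W ∨ Leibniz.product W ⊤ = W)) ∧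
    (IsGreatest (Leibniz.nilpotentIdeals F L) (Leibniz.nilradical F L) ∧
      Leibniz.nilradical F L = Leibniz.derivedSeries F L n) ∧
    Leibniz.nilradical F L = Leibniz.centralizer W ∧
    (Leibniz.IsPhiFree F L ↔ W = Leibniz.nilradical F L) := by
  have hN : Leibniz.nilradical F L = Leibniz.derivedSeries F L n :=
    (hW.isGreatest_derivedSeries hA hn).isLUB.sSup_eq
  rw [hN]
  refine ⟨hW.isAbelian hn, fun h1 => ?_, ⟨hW.isGreatest_derivedSeries hA hn, rfl⟩,
    (hW.centralizer_eq hA hn).symm, hW.isPhiFree_iff hA hn⟩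
  obtain ⟨n, rfl⟩ := Nat.exists_eq_add_of_le' h1
  exact ⟨hW.center_eq_bot hA hn, Or.inr (hW.product_top_eq hA hn)⟩
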